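/- Let $n\ge 1$. Let $\mathcal C$ be the class of convex functions $\Phi:\mathbb R^n\to\mathbb R\cup\{+\infty\}$ that are even, whose domain $\{\Phi<+\infty\}$ has nonempty interior, and that satisfy $\Phi(x)\to+\infty$ as $|x|\to\infty$. Let $\mathcal C_{1s}$ be the set of $1$-symmetric functions in $\mathcal C$, i.e. those with $\Phi(\epsilon_1x_1,\dots,\epsilon_nx_n)=\Phi(x)=\Phi(x_{\sigma(1)},\dots,x_{\sigma(n)})$ for all $x$, all signs $\epsilon_i\in\{-1,1\}$ and all permutations $\sigma$. Write $\Phi^*(y)=\sup_x(\langle x,y\rangle-\Phi(x))$ for the Legendre transform. A function $f$ on $\mathbb R^n$ is called $s$-homogeneous if $f(\lambda x)=\lambda^s f(x)$ for all $\lambda>0$ and $x\ne 0$. All integrals below are of nonnegative functions and take values in $[0,+\infty]$, with $0\cdot\infty=0$. (1) Let $\alpha,\beta>0$, $s,t>-n$, and let $\rho_1,\rho_2:\mathbb R^n\to[0,\infty)$ be (Lebesgue) measurable, $\rho_1$ being $s$-homogeneous and $\rho_2$ being $t$-homogeneous, with $$\frac{\alpha}{\beta}=\frac{n+s}{n+t}.$$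 Then the functional $$\mathcal{BS}_{\alpha,\beta,\rho_1,\rho_2}(\Phi)=\Bigl(\int_{\mathbb R^n}e^{-\alpha\Phi(x)}\rho_1(x)\,dx\Bigr)^{1/\alpha}\Bigl(\int_{\mathbb R^n}e^{-\beta\Phi^*(y)}\rho_2(y)\,dy\Bigr)^{1/\beta}$$ attains a maximum on $\mathcal C_{1s}$; that is, there is $\Phi_0\in\mathcal C_{1s}$ with $\mathcal{BS}_{\alpha,\beta,\rho_1,\rho_2}(\Psi)\le\mathcal{BS}_{\alpha,\beta,\rho_1,\rho_2}(\Phi_0)$ for all $\Psi\in\mathcal C_{1s}$. If $\rho_1$ and $\rho_2$ are locally integrable, this maximum is finite. (2) Let $p>1$ and let $V:\mathbb R^n\to\mathbb R$ be a $p$-homogeneous convex function. Then the functional $$\mathcal{BS}_{p,V}(\Phi)=\int_{\mathbb R^n}e^{-\Phi(x)}\,dx\,\Bigl(\int_{\mathbb R^n}e^{-\frac1{p-1}\Phi^*(\nabla V(y))}\,dy\Bigr)^{p-1}$$ (where $\nabla V(y)$ exists for almost every $y$) attains a maximum on $\mathcal C_{1s}$. If $V(x)>0$ for all $x\neq0$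 (as is the case when $V$ is strictly convex), this maximum is finite. -/

import Mathlib

open MeasureTheory Filter Topology

noncomputable section

namespace BlaschkeSantalo

/-- `ℝⁿ` with its Euclidean structure. -/
abbrev E (n : ℕ) : Type := EuclideanSpace ℝ (Fin n)

/-- Convexity of an extended-real-valued function: its epigraph is a convex set. -/
def IsConvexFun {n : ℕ} (Φ : E n → EReal) : Prop :=
  Convex ℝ {q : E n × ℝ | Φ q.1 ≤ (q.2 : EReal)}

/-- The effective domain `dom Φ = {x | Φ x < +∞}`. -/
def effDom {n : ℕ} (Φ : E n → EReal) : Set (E n) := {x | Φ x < ⊤}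

/-- The Legendre transform `Φ*(y) = sup_x (⟨x, y⟩ - Φ x)`. -/
def legendre {n : ℕ} (Φ : E n → EReal) (y : E n) : EReal :=
  ⨆ x : E n, (((inner ℝ x y : ℝ) : EReal) - Φ x)

/-- The class `𝒞` of even, coercive convex functions `Φ : ℝⁿ → ℝ ∪ {+∞}` whose domain has
nonempty interior. -/
structure IsClassC {n : ℕ} (Φ : E n → EReal) : Prop where
  ne_bot : ∀ x, Φ x ≠ ⊥
  convex : IsConvexFun Φ
  even : ∀ x, Φ (-x) = Φ x
  interior_dom : (interior (effDom Φ)).Nonempty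
  coercive : Tendsto Φ (cocompact (E n)) (𝓝 ⊤)

/-- `1`-symmetric functions: invariant under all sign changes and all permutations of the
coordinates. -/
def IsOneSymmetric {n : ℕ} (Φ : E n → EReal) : Prop :=
  (∀ (ε : Fin n → ℝ), (∀ i, ε i = 1 ∨ ε i = -1) →
      ∀ x : E n, Φ (WithLp.toLp 2 fun i => ε i * x i) = Φ x) ∧
  (∀ (σ : Equiv.Perm (Fin n)) (x : E n), Φ (WithLp.toLp 2 fun i => x (σ i)) = Φ x)

/-- The set of `1`-symmetric functions in the class `𝒞`. -/
def classOneSymmetric (n : ℕ) : Set (E n → EReal) :=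
  {Φ | IsClassC Φ ∧ IsOneSymmetric Φ}

/-- Positive homogeneity of (real) degree `s`. The value at the origin is not constrained, so
that negative degrees (where `f` is naturally defined only off the origin) are included. -/
def IsHomogeneousOfDegree {n : ℕ} (s : ℝ) (f : E n → ℝ) : Prop :=
  ∀ (r : ℝ) (x : E n), 0 < r → x ≠ 0 → f (r • x) = r ^ s * f x

/-- The weighted Blaschke–Santaló functional
`(∫ e^{-αΦ} ρ₁ dx)^{1/α} (∫ e^{-βΦ*} ρ₂ dy)^{1/β}`, with values in `[0, ∞]`. -/
def BS {n : ℕ} (α β : ℝ) (ρ₁ ρ₂ : E n → ℝ) (Φ : E n → EReal) : ENNReal :=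
  (∫⁻ x, EReal.exp (-((α : EReal) * Φ x)) * ENNReal.ofReal (ρ₁ x)) ^ (1 / α) *
    (∫⁻ y, EReal.exp (-((β : EReal) * legendre Φ y)) * ENNReal.ofReal (ρ₂ y)) ^ (1 / β)

/-- The functional `∫ e^{-Φ} dx (∫ e^{-Φ*(∇V(y))/(p-1)} dy)^{p-1}`, with values in `[0, ∞]`.
It is used for finite convex `V`, for which `∇V(y)` exists for almost every `y`. -/
def BSV {n : ℕ} (p : ℝ) (V : E n → ℝ) (Φ : E n → EReal) : ENNReal :=
  (∫⁻ x, EReal.exp (-Φ x)) *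
    (∫⁻ y, EReal.exp (-(((1 / (p - 1) : ℝ) : EReal) * legendre Φ (gradient V y)))) ^ (p - 1)

end BlaschkeSantalo

end

/-!
Replacing `Φ` by `Φ(r x) + c` does not change the functional, by the relation between the
exponents and the degrees of homogeneity. Dilating and shifting, a `1`-symmetric function can be
normalized so that it lies above `c ‖x‖ - 1` and is at most `1` on the ball of radius `c`, for a
constant `c` depending only on `n`; its Legendre transform then has the same lower bound. Along a
maximizing sequence of normalized functions, converging at all rational points, these bounds
provide dominating functions for both integrals, and the pointwise limsup `Φ₀` is again
normalized.

The Legendre transform of `Φ₀` is at most the liminf of the Legendre transforms, so the second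
integral is handled by the reverse Fatou lemma. For the first one, a `1`-symmetric convex function
increases with each `|x i|`, and between `|x i|` and `r |x i|`, `r > 1`, there is a rational point:
hence `Φ₀(x) ≤ liminf Φ_k(r x)`, and reverse Fatou, homogeneity and `r → 1` conclude.

The gradient functional is the case of Lebesgue measure and its image under `∇V`, which is
homogeneous of degree `n / (p - 1)`. If one of the two measures is infinite on the unit ball, and
neither vanishes, the Euclidean norm has infinite functional.
-/

namespace BlaschkeSantalo

variable {n : ℕ}

/-! ### Convex functions -/

section Convexity

variable {Φ : E n → EReal}

theorem isConvexFun_of_lt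
    (h : ∀ (x y : E n) (c d a b : ℝ), Φ x < c → Φ y < d → 0 ≤ a → 0 ≤ b → a + b = 1 →
      Φ (a • x + b • y) ≤ ((a * c + b * d : ℝ) : EReal)) : IsConvexFun Φ := by
  rintro ⟨x, c⟩ hx ⟨y, d⟩ hy a b ha hb hab
  refine EReal.le_of_forall_lt_iff_le.1 fun m hm => ?_
  set δ : ℝ := m - (a * c + b * d)
  have hδ : 0 < δ := sub_pos.2 (EReal.coe_lt_coe_iff.1 hm)
  have lt_add_δ {v : EReal} {e : ℝ} (hv : v ≤ e) : v < ((e + δ : ℝ) : EReal) :=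
    hv.trans_lt (EReal.coe_lt_coe_iff.2 (lt_add_of_pos_right e hδ))
  refine (h x y (c + δ) (d + δ) a b (lt_add_δ hx) (lt_add_δ hy) ha hb hab).trans_eq ?_
  congr 1
  linear_combination δ * hab

theorem IsConvexFun.le_of_le (h : IsConvexFun Φ) {x y : E n} {c d a b : ℝ} (hx : Φ x ≤ c)
    (hy : Φ y ≤ d) (ha : 0 ≤ a) (hb : 0 ≤ b) (hab : a + b = 1) :
    Φ (a • x + b • y) ≤ ((a * c + b * d : ℝ) : EReal) :=
  h (x := (x, c)) (y := (y, d)) hx hy ha hb hab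

theorem IsConvexFun.convex_le (h : IsConvexFun Φ) (c : EReal) : Convex ℝ {x | Φ x ≤ c} := by
  intro x hx y hy a b ha hb hab
  refine EReal.le_of_forall_lt_iff_le.1 fun m hm => ?_
  have hle := h.le_of_le (hx.trans hm.le) (hy.trans hm.le) ha hb hab
  rwa [← add_mul, hab, one_mul] at hle

theorem IsConvexFun.convex_lt (h : IsConvexFun Φ) (c : EReal) : Convex ℝ {x | Φ x < c} := by
  intro x hx y hy a b ha hb hab
  have hmax : Φ (a • x + b • y) ≤ max (Φ x) (Φ y) :=
    h.convex_le _ (le_max_left (Φ x) (Φ y)) (le_max_right (Φ x) (Φ y)) ha hb hab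
  exact hmax.trans_lt (max_lt hx hy)

theorem IsConvexFun.aemeasurable (h : IsConvexFun Φ) : AEMeasurable Φ volume :=
  NullMeasurable.aemeasurable
    (measurable_of_Iio fun c => (h.convex_lt c).nullMeasurableSet volume)

theorem IsConvexFun.comp_smul (h : IsConvexFun Φ) (r : ℝ) : IsConvexFun fun x => Φ (r • x) := by
  refine isConvexFun_of_lt fun x y c d a b hx hy ha hb hab => ?_
  rw [smul_add, smul_comm r a, smul_comm r b]
  exact h.le_of_le hx.le hy.le ha hb hab

theorem IsConvexFun.add_coe (h : IsConvexFun Φ) (c : ℝ) :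
    IsConvexFun fun x => Φ x + (c : EReal) := by
  have add_le_iff (v : EReal) (e : ℝ) : v + (c : EReal) ≤ e ↔ v ≤ ((e - c : ℝ) : EReal) := by
    rw [EReal.coe_sub, EReal.le_sub_iff_add_le (by simp) (by simp)]
  refine isConvexFun_of_lt fun x y d e a b hx hy ha hb hab => (add_le_iff _ _).2 ?_
  refine (h.le_of_le ((add_le_iff _ _).1 hx.le) ((add_le_iff _ _).1 hy.le) ha hb hab).trans_eq ?_
  congr 1
  linear_combination -c * hab

theorem IsConvexFun.mul_le_apply_smul (h : IsConvexFun Φ) (h0 : Φ 0 ≤ 0) {x : E n} {m t : ℝ}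
    (hm : m ≤ Φ x) (ht : 1 ≤ t) : ((t * m : ℝ) : EReal) ≤ Φ (t • x) := by
  have htpos : 0 < t := one_pos.trans_le ht
  refine EReal.le_of_forall_lt_iff_le.1 fun c hc => ?_
  have hcomb := h.le_of_le hc.le (y := 0) (d := 0) h0 (a := t⁻¹) (b := 1 - t⁻¹)
    (by positivity) (sub_nonneg.2 (inv_le_one_of_one_le₀ ht)) (by ring)
  rw [smul_zero, add_zero, inv_smul_smul₀ htpos.ne', mul_zero, add_zero] at hcomb
  have hmc : m ≤ t⁻¹ * c := EReal.coe_le_coe_iff.1 (hm.trans hcomb)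
  exact EReal.coe_le_coe_iff.2 ((le_inv_mul_iff₀ htpos).1 hmc)

theorem IsConvexFun.limsup {ι : Type*} {l : Filter ι} {Ψ : ι → E n → EReal}
    (h : ∀ k, IsConvexFun (Ψ k)) : IsConvexFun fun x => limsup (fun k => Ψ k x) l := by
  refine isConvexFun_of_lt fun x y c d a b hx hy ha hb hab => limsup_le_of_le (h := ?_)
  filter_upwards [eventually_lt_of_limsup_lt hx, eventually_lt_of_limsup_lt hy] with k hkx hky
  exact (h k).le_of_le hkx.le hky.le ha hb hab

end Convexity

/-! ### Symmetric functions -/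

section Symmetry

variable {Φ : E n → EReal}

/-- Unconditional functions, that is functions invariant under all sign changes of the
coordinates: the part of `1`-symmetry which makes a convex function monotone in each `|x i|`. -/
def IsUnconditional (Φ : E n → EReal) : Prop :=
  ∀ ε : Fin n → ℝ, (∀ i, ε i = 1 ∨ ε i = -1) →
    ∀ x : E n, Φ (WithLp.toLp 2 fun i => ε i * x i) = Φ x

theorem IsOneSymmetric.isUnconditional (hs : IsOneSymmetric Φ) : IsUnconditional Φ := hs.1

theorem IsUnconditional.even (hs : IsUnconditional Φ) (x : E n) : Φ (-x) = Φ x := by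
  rw [← hs (fun _ => -1) (fun _ => .inr rfl) x]
  congr 1
  ext i
  simp

/- For fixed `y`, the vectors `a` with `Φ (a i * y i) ≤ Φ y` form a convex set containing
`{-1, 1}ⁿ`, hence the whole cube `[-1, 1]ⁿ`. -/
theorem IsConvexFun.le_of_abs_le (h : IsConvexFun Φ) (hs : IsUnconditional Φ) {x y : E n}
    (hxy : ∀ i, |x i| ≤ |y i|) : Φ x ≤ Φ y := by
  let scale : (Fin n → ℝ) →ₗ[ℝ] E n :=
    (WithLp.linearEquiv 2 ℝ (Fin n → ℝ)).symm.toLinearMap ∘ₗ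
      LinearMap.pi fun i => LinearMap.toSpanSingleton ℝ ℝ (y i) ∘ₗ LinearMap.proj i
  have signs_subset : (Set.univ.pi fun _ => {-1, 1}) ⊆ scale ⁻¹' {z | Φ z ≤ Φ y} :=
    fun ε hε => (hs ε (fun i => (hε i trivial).symm) y).le
  have cube_subset := convexHull_min signs_subset ((h.convex_le (Φ y)).linear_preimage scale)
  rw [convexHull_pi] at cube_subset
  have hx : x = scale fun i => x i / y i := by
    ext i
    rcases eq_or_ne (y i) 0 with hy | hy
    · simpa [scale, hy] using hxy i
    · simp [scale, hy]
  rw [hx]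
  refine cube_subset fun i _ => ?_
  rw [convexHull_pair, segment_eq_Icc (by norm_num), Set.mem_Icc, ← abs_le, abs_div]
  exact div_le_one_of_le₀ (hxy i) (abs_nonneg _)

theorem IsOneSymmetric.apply_single_eq (hs : IsOneSymmetric Φ) (i j : Fin n) (t : ℝ) :
    Φ (EuclideanSpace.single i t) = Φ (EuclideanSpace.single j t) := by
  rw [← hs.2 (Equiv.swap i j) (EuclideanSpace.single j t)]
  congr 1
  ext k
  simp [Equiv.swap_apply_eq_iff]

theorem IsOneSymmetric.comp_smul (hs : IsOneSymmetric Φ) (r : ℝ) :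
    IsOneSymmetric fun x => Φ (r • x) := by
  refine ⟨fun ε hε x => ?_, fun σ x => hs.2 σ (r • x)⟩
  refine Eq.trans (congrArg Φ ?_) (hs.1 ε hε (r • x))
  ext i
  exact mul_left_comm _ _ _

theorem IsOneSymmetric.add_coe (hs : IsOneSymmetric Φ) (c : ℝ) :
    IsOneSymmetric fun x => Φ x + (c : EReal) :=
  ⟨fun ε hε x => congrArg (· + (c : EReal)) (hs.1 ε hε x),
    fun σ x => congrArg (· + (c : EReal)) (hs.2 σ x)⟩

theorem IsOneSymmetric.limsup {ι : Type*} {l : Filter ι} {Ψ : ι → E n → EReal}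
    (h : ∀ k, IsOneSymmetric (Ψ k)) : IsOneSymmetric fun x => limsup (fun k => Ψ k x) l :=
  ⟨fun ε hε x => by simp_rw [fun k => (h k).1 ε hε x],
    fun σ x => by simp_rw [fun k => (h k).2 σ x]⟩

end Symmetry

/-! ### Sublevel sets of functions in the class `𝒞` -/

section ClassC

variable {Φ : E n → EReal}

theorem IsClassC.apply_zero_le (h : IsClassC Φ) (x : E n) : Φ 0 ≤ Φ x := by
  have hmid := h.convex.convex_le (Φ x) (le_refl (Φ x)) (h.even x).le (a := 1 / 2) (b := 1 / 2)
    (by norm_num) (by norm_num) (by norm_num)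
  rwa [smul_neg, add_neg_cancel] at hmid

theorem IsClassC.exists_apply_zero (h : IsClassC Φ) : ∃ c : ℝ, Φ 0 = c := by
  obtain ⟨x, hx⟩ := h.interior_dom
  have hx_dom : x ∈ effDom Φ := interior_subset hx
  exact ⟨_, (EReal.coe_toReal ((h.apply_zero_le x).trans_lt hx_dom).ne (h.ne_bot 0)).symm⟩

theorem IsClassC.effDom_mem_nhds_zero (h : IsClassC Φ) : effDom Φ ∈ 𝓝 0 := by
  obtain ⟨x, hx⟩ := h.interior_dom
  have hx_dom : x ∈ effDom Φ := interior_subset hx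
  have hmid := (h.convex.convex_lt ⊤).combo_interior_self_mem_interior hx
    ((h.even x).trans_lt hx_dom) (a := 1 / 2) (b := 1 / 2)
    (by norm_num) (by norm_num) (by norm_num)
  rw [smul_neg, add_neg_cancel] at hmid
  exact mem_interior_iff_mem_nhds.1 hmid

theorem IsClassC.absorbent_le (h : IsClassC Φ) {m : ℝ} (hm : Φ 0 < m) :
    Absorbent ℝ {x | Φ x ≤ m} := by
  rw [absorbent_iff_eventually_nhdsNE_zero]
  intro x
  obtain ⟨c₀, hc₀⟩ := h.exists_apply_zero
  have hc₀m : c₀ < m := EReal.coe_lt_coe_iff.1 (hc₀ ▸ hm)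
  obtain ⟨t, ht_dom, ht⟩ : ∃ t : ℝ, t • x ∈ effDom Φ ∧ t ∈ Set.Ioi 0 := by
    have hray : Tendsto (fun t : ℝ => t • x) (𝓝[>] 0) (𝓝 0) :=
      (Continuous.tendsto' (by fun_prop) 0 0 (zero_smul ℝ x)).mono_left nhdsWithin_le_nhds
    exact ((hray.eventually_mem h.effDom_mem_nhds_zero).and self_mem_nhdsWithin).exists
  rw [Set.mem_Ioi] at ht
  obtain ⟨M, hM, -⟩ := EReal.lt_iff_exists_real_btwn.1 ht_dom
  have hsmall : ∀ᶠ r : ℝ in 𝓝 0, |r| / t < 1 :=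
    ContinuousAt.eventually_lt (by fun_prop) continuousAt_const (by simp)
  have hinterp : ∀ᶠ r : ℝ in 𝓝 0, |r| / t * M + (1 - |r| / t) * c₀ < m :=
    ContinuousAt.eventually_lt (by fun_prop) continuousAt_const (by simpa using hc₀m)
  filter_upwards [nhdsWithin_le_nhds hsmall, nhdsWithin_le_nhds hinterp] with r hr hrm
  have hcomb := h.convex.le_of_le hM.le hc₀.le (a := |r| / t) (b := 1 - |r| / t)
    (by positivity) (sub_nonneg.2 hr.le) (by ring)
  rw [smul_zero, add_zero, smul_smul, div_mul_cancel₀ _ ht.ne'] at hcomb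
  have heven : Φ (r • x) = Φ (|r| • x) := by
    rcases abs_choice r with hr | hr <;> rw [hr]
    rw [neg_smul, h.even]
  exact heven.trans_le (hcomb.trans (EReal.coe_le_coe_iff.2 hrm.le))

theorem isBounded_le_of_tendsto_cocompact {X : Type*} [PseudoMetricSpace X] [ProperSpace X]
    {f : X → EReal} (h : Tendsto f (cocompact X) (𝓝 ⊤)) {c : EReal} (hc : c < ⊤) :
    Bornology.IsBounded {x | f x ≤ c} := by
  rw [Bornology.isBounded_def, Metric.cobounded_eq_cocompact]
  filter_upwards [h.eventually_const_lt hc] with x hx using not_le.2 hx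

theorem IsClassC.exists_dilation (h : IsClassC Φ) {m : ℝ} (hm : Φ 0 < m) {x : E n}
    (hx : x ≠ 0) :
    ∃ r : ℝ, 0 < r ∧ Φ (r • (1 / 2 : ℝ) • x) ≤ m ∧ m ≤ Φ (r • (2 : ℝ) • x) := by
  set S : Set (E n) := {x | Φ x ≤ m}
  have hS := h.absorbent_le hm
  have hgauge : 0 < gauge S x := (gauge_pos hS
    ((NormedSpace.isVonNBounded_iff ℝ).2
      (isBounded_le_of_tendsto_cocompact h.coercive (EReal.coe_lt_top m)))).2 hx
  have gauge_dilation {t : ℝ} (ht : 0 ≤ t) : gauge S ((gauge S x)⁻¹ • t • x) = t := by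
    rw [gauge_smul_of_nonneg (by positivity), gauge_smul_of_nonneg ht, smul_eq_mul, smul_eq_mul,
      mul_left_comm, inv_mul_cancel₀ hgauge.ne', mul_one]
  refine ⟨(gauge S x)⁻¹, inv_pos.2 hgauge, ?_, ?_⟩
  · refine setOfPred_gauge_lt_one_subset_self (h.convex.convex_le m) hm.le hS ?_
    exact (gauge_dilation (by norm_num)).trans_lt (by norm_num)
  · by_contra! hlt
    have hle : gauge S _ ≤ 1 := gauge_le_one_of_mem hlt.le
    rw [gauge_dilation (by norm_num)] at hle
    norm_num at hle

end ClassC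

/-! ### The exponential weight and the Legendre transform -/

section ExpNeg

variable {a : ℝ}

/-- The weight `e^{-av}` of an extended real `v`, which turns `BS` into a functional of two
measures. -/
noncomputable def expNeg (a : ℝ) (v : EReal) : ENNReal := EReal.exp (-((a : EReal) * v))

theorem expNeg_antitone (ha : 0 ≤ a) : Antitone (expNeg a) := fun _ _ h =>
  EReal.exp_monotone
    (EReal.neg_le_neg_iff.2 (mul_le_mul_of_nonneg_left h (EReal.coe_nonneg.2 ha)))

theorem expNeg_coe (a v : ℝ) : expNeg a v = ENNReal.ofReal (Real.exp (-(a * v))) := by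
  rw [expNeg, ← EReal.coe_mul, ← EReal.coe_neg, EReal.exp_coe]

theorem expNeg_coe_ne_zero (a v : ℝ) : expNeg a v ≠ 0 := by
  simp [expNeg_coe, Real.exp_pos]

theorem continuous_expNeg (ha : 0 < a) : Continuous (expNeg a) := by
  refine ENNReal.continuous_exp.comp (continuous_neg.comp ?_)
  rw [continuous_iff_continuousAt]
  intro v
  exact (EReal.continuousAt_mul (p := ((a : EReal), v)) (by simp [ha.ne']) (by simp [ha.ne'])
    (by simp) (by simp)).comp (f := fun v : EReal => ((a : EReal), v)) (by fun_prop)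

theorem measurable_expNeg (ha : 0 < a) : Measurable (expNeg a) :=
  (continuous_expNeg ha).measurable

theorem expNeg_add_coe (ha : 0 < a) (v : EReal) (c : ℝ) :
    expNeg a (v + c) = expNeg a v * ENNReal.ofReal (Real.exp (-(a * c))) := by
  rw [← expNeg_coe, expNeg, expNeg, expNeg, ← EReal.exp_add]
  congr 1
  induction v with
  | bot =>
    simp [EReal.coe_mul_bot_of_pos ha, EReal.top_add_of_ne_bot, ← EReal.coe_mul, ← EReal.coe_neg]
  | top => simp [EReal.coe_mul_top_of_pos ha]
  | coe v => norm_cast; ring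

theorem limsup_expNeg (ha : 0 < a) {ι : Type*} {l : Filter ι} [l.NeBot] (u : ι → EReal) :
    limsup (fun k => expNeg a (u k)) l = expNeg a (liminf u l) :=
  ((expNeg_antitone ha.le).map_liminf_of_continuousAt u (continuous_expNeg ha).continuousAt).symm

end ExpNeg

section Legendre

variable {Φ : E n → EReal}

theorem le_legendre (Φ : E n → EReal) (x y : E n) :
    ((inner ℝ x y : ℝ) : EReal) - Φ x ≤ legendre Φ y :=
  le_iSup (fun x : E n => ((inner ℝ x y : ℝ) : EReal) - Φ x) x

theorem measurable_legendre (Φ : E n → EReal) : Measurable (legendre Φ) := by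
  refine LowerSemicontinuous.measurable (lowerSemicontinuous_iSup fun x => ?_)
  induction hx : Φ x with
  | bot => simpa using lowerSemicontinuous_const
  | top => simpa using lowerSemicontinuous_const
  | coe c =>
    simp_rw [← EReal.coe_sub]
    exact (continuous_coe_real_ereal.comp (by fun_prop)).lowerSemicontinuous

/-- The dilate `x ↦ Φ (r x) + c` of `Φ` by `r`, shifted by `c`: the two operations used to
normalize a function without changing the value of the functional. -/
noncomputable def rescale (r c : ℝ) (Φ : E n → EReal) : E n → EReal :=
  fun x => Φ (r • x) + (c : EReal)

theorem IsConvexFun.rescale (h : IsConvexFun Φ) (r c : ℝ) : IsConvexFun (rescale r c Φ) :=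
  (h.comp_smul r).add_coe c

theorem IsOneSymmetric.rescale (h : IsOneSymmetric Φ) (r c : ℝ) :
    IsOneSymmetric (rescale r c Φ) :=
  (h.comp_smul r).add_coe c

theorem legendre_rescale {r : ℝ} (hr : r ≠ 0) (c : ℝ) (Φ : E n → EReal) (y : E n) :
    legendre (rescale r c Φ) y = legendre Φ (r⁻¹ • y) + ((-c : ℝ) : EReal) := by
  have hterm (x : E n) : ((inner ℝ x y : ℝ) : EReal) - rescale r c Φ x =
      ((inner ℝ (r • x) (r⁻¹ • y) : ℝ) : EReal) - Φ (r • x) + ((-c : ℝ) : EReal) := by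
    rw [rescale, real_inner_smul_left, real_inner_smul_right, mul_inv_cancel_left₀ hr]
    induction Φ (r • x) with
    | bot => simp
    | top => simp
    | coe v => norm_cast; ring
  refine le_antisymm (iSup_le fun x => ?_) ?_
  · exact (hterm x).trans_le (add_le_add_left (le_legendre Φ _ _) _)
  · rw [EReal.coe_neg, ← sub_eq_add_neg, EReal.sub_le_iff_le_add (by simp) (by simp)]
    refine iSup_le fun x => ?_
    have hle := le_legendre (rescale r c Φ) (r⁻¹ • x) y
    rwa [hterm, smul_inv_smul₀ hr, EReal.coe_neg, ← sub_eq_add_neg,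
      EReal.sub_le_iff_le_add (by simp) (by simp)] at hle

theorem legendre_limsup_le {ι : Type*} {l : Filter ι} (Φ : ι → E n → EReal) (y : E n) :
    legendre (fun x => limsup (fun k => Φ k x) l) y ≤ liminf (fun k => legendre (Φ k) y) l := by
  refine iSup_le fun x => EReal.ge_of_forall_gt_iff_ge.1 fun m hm => ?_
  have hlt : limsup (fun k => Φ k x) l < ((inner ℝ x y - m : ℝ) : EReal) := by
    rw [EReal.coe_sub, EReal.lt_sub_iff_add_lt (by simp) (by simp), add_comm]
    exact (EReal.lt_sub_iff_add_lt (by simp) (by simp)).1 hm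
  refine le_liminf_of_le (h := ?_)
  filter_upwards [eventually_lt_of_limsup_lt hlt] with k hk
  calc (m : EReal) = ((inner ℝ x y : ℝ) : EReal) - ((inner ℝ x y - m : ℝ) : EReal) := by
        norm_cast
        ring
    _ ≤ ((inner ℝ x y : ℝ) : EReal) - Φ k x := EReal.sub_le_sub le_rfl hk.le
    _ ≤ legendre (Φ k) y := le_legendre (Φ k) x y

theorem limsup_expNeg_legendre_le {β : ℝ} (hβ : 0 < β) {ι : Type*} {l : Filter ι} [l.NeBot]
    (Φ : ι → E n → EReal) (y : E n) :
    limsup (fun k => expNeg β (legendre (Φ k) y)) l ≤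
      expNeg β (legendre (fun x => limsup (fun k => Φ k x) l) y) :=
  (limsup_expNeg hβ _).trans_le (expNeg_antitone hβ.le (legendre_limsup_le Φ y))

end Legendre

/-! ### Homogeneous measures -/

/-- Homogeneity of degree `a` of a measure: dilating a set by `r > 0` multiplies its measure by
`r ^ a`. It is expressed through `μ.map (r • ·)`, whose value at `A` is `μ (r⁻¹ • A)`, hence the
exponent `-a`. Both weights `ρ dx` and push-forwards of `dx` by gradients are of this kind. -/
def IsHomogeneousMeasure {F : Type*} [SMul ℝ F] [MeasurableSpace F] (a : ℝ) (μ : Measure F) :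
    Prop :=
  ∀ r : ℝ, 0 < r → μ.map (r • ·) = ENNReal.ofReal (r ^ (-a)) • μ

namespace IsHomogeneousMeasure

theorem lintegral_comp_smul {F : Type*} [MulAction ℝ F] [MeasurableSpace F]
    [MeasurableConstSMul ℝ F] {a : ℝ} {μ : Measure F} (h : IsHomogeneousMeasure a μ) {r : ℝ}
    (hr : 0 < r) (f : F → ENNReal) :
    ∫⁻ x, f (r • x) ∂μ = ENNReal.ofReal (r ^ (-a)) * ∫⁻ x, f x ∂μ := by
  rw [← (measurableEmbedding_const_smul₀ hr.ne').lintegral_map f, h r hr, lintegral_smul_measure,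
    smul_eq_mul]

theorem map {F G : Type*} [MulAction ℝ F] [MeasurableSpace F] [MeasurableConstSMul ℝ F]
    [MulAction ℝ G] [MeasurableSpace G] [MeasurableConstSMul ℝ G] {a q : ℝ} {μ : Measure F}
    (h : IsHomogeneousMeasure a μ) {f : F → G} (hf : Measurable f) (hq : q ≠ 0)
    (hfq : ∀ r : ℝ, 0 < r → ∀ᵐ x ∂μ, f (r • x) = r ^ q • f x) :
    IsHomogeneousMeasure (a / q) (μ.map f) := by
  intro r hr
  set t : ℝ := r ^ (1 / q) with ht
  have ht0 : 0 < t := Real.rpow_pos_of_pos hr _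
  have htq : t ^ q = r := by
    rw [ht, ← Real.rpow_mul hr.le, one_div_mul_cancel hq, Real.rpow_one]
  have hcomp : (r • ·) ∘ f =ᵐ[μ] f ∘ (t • ·) := by
    filter_upwards [hfq t ht0] with x hx
    rw [Function.comp_apply, Function.comp_apply, hx, htq]
  rw [Measure.map_map (measurable_const_smul r) hf, Measure.map_congr hcomp,
    ← Measure.map_map hf (measurable_const_smul t), h t ht0, Measure.map_smul, ht,
    ← Real.rpow_mul hr.le, mul_neg, one_div_mul_eq_div]

theorem withDensity {a s : ℝ} {μ : Measure (E n)} [NullSingletonClass μ]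
    (h : IsHomogeneousMeasure a μ) {ρ : E n → ℝ} (hρ : IsHomogeneousOfDegree s ρ) :
    IsHomogeneousMeasure (a + s) (μ.withDensity fun x => ENNReal.ofReal (ρ x)) := by
  intro r hr
  ext A hA
  have hA' : MeasurableSet ((r • ·) ⁻¹' A : Set (E n)) := measurable_const_smul r hA
  have hdensity : ∀ᵐ x ∂μ, ((r • ·) ⁻¹' A).indicator (fun x => ENNReal.ofReal (ρ x)) x =
      ENNReal.ofReal (r ^ (-s)) * A.indicator (fun x => ENNReal.ofReal (ρ x)) (r • x) := by
    filter_upwards [Measure.ae_ne μ (0 : E n)] with x hx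
    by_cases hxA : r • x ∈ A
    · rw [Set.indicator_of_mem (show x ∈ (r • ·) ⁻¹' A from hxA), Set.indicator_of_mem hxA,
        hρ r x hr hx, ← ENNReal.ofReal_mul (by positivity), ← mul_assoc, ← Real.rpow_add hr,
        neg_add_cancel, Real.rpow_zero, one_mul]
    · rw [Set.indicator_of_notMem (show x ∉ (r • ·) ⁻¹' A from hxA), Set.indicator_of_notMem hxA,
        mul_zero]
  rw [(measurableEmbedding_const_smul₀ hr.ne').map_apply, withDensity_apply _ hA',
    Measure.smul_apply, withDensity_apply _ hA, ← lintegral_indicator hA', ← lintegral_indicator hA,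
    lintegral_congr_ae hdensity, lintegral_const_mul' _ _ ENNReal.ofReal_ne_top,
    h.lintegral_comp_smul hr, ← mul_assoc, ← ENNReal.ofReal_mul (by positivity),
    ← Real.rpow_add hr, smul_eq_mul, neg_add_rev]

section NormedSpace

variable {F : Type*} [NormedAddCommGroup F] [NormedSpace ℝ F] [MeasurableSpace F] [BorelSpace F]
  {a : ℝ} {μ : Measure F}

theorem closedBall_eq (h : IsHomogeneousMeasure a μ) {r : ℝ} (hr : 0 < r) :
    μ (Metric.closedBall 0 r) = ENNReal.ofReal (r ^ a) * μ (Metric.closedBall 0 1) := by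
  have hpre : (r⁻¹ • ·) ⁻¹' Metric.closedBall (0 : F) 1 = Metric.closedBall 0 r := by
    rw [Set.preimage_smul_inv₀ hr.ne', smul_unitClosedBall, Real.norm_of_nonneg hr.le]
  rw [← hpre, ← (measurableEmbedding_const_smul₀ (inv_ne_zero hr.ne')).map_apply,
    h r⁻¹ (inv_pos.2 hr), Measure.smul_apply, smul_eq_mul, Real.inv_rpow hr.le,
    Real.rpow_neg hr.le, inv_inv]

theorem eq_zero (h : IsHomogeneousMeasure a μ) (h0 : μ (Metric.closedBall 0 1) = 0) : μ = 0 := by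
  rw [← Measure.measure_univ_eq_zero, ← Metric.iUnion_closedBall_nat (0 : F)]
  refine measure_iUnion_null fun k => ?_
  refine measure_mono_null (Metric.closedBall_subset_closedBall (Nat.cast_le.2 k.le_succ)) ?_
  rw [h.closedBall_eq (by positivity), h0, mul_zero]

end NormedSpace

end IsHomogeneousMeasure

theorem ofReal_exp_neg_mul_norm_le_tsum {F : Type*} [SeminormedAddCommGroup F] {c : ℝ}
    (hc : 0 ≤ c) (x : F) :
    ENNReal.ofReal (Real.exp (-(c * ‖x‖))) ≤
      ∑' k : ℕ, (Metric.closedBall (0 : F) (k + 1 : ℝ)).indicator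
        (fun _ => ENNReal.ofReal (Real.exp (-(c * k)))) x := by
  refine le_trans ?_ (ENNReal.le_tsum ⌊‖x‖⌋₊)
  rw [Set.indicator_of_mem (by simpa using (Nat.lt_floor_add_one ‖x‖).le)]
  gcongr
  exact Nat.floor_le (norm_nonneg x)

theorem summable_exp_neg_mul_rpow {c : ℝ} (hc : 0 < c) (a : ℝ) :
    Summable fun k : ℕ => Real.exp (-(c * k)) * (k + 1 : ℝ) ^ a := by
  obtain ⟨N, hN⟩ := exists_nat_ge a
  have hshift := ((summable_nat_add_iff 1).2
    (Real.summable_pow_mul_exp_neg_nat_mul N hc)).mul_left (Real.exp c)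
  refine hshift.of_nonneg_of_le (fun k => by positivity) fun k => ?_
  calc Real.exp (-(c * k)) * (k + 1 : ℝ) ^ a ≤ Real.exp (-(c * k)) * (k + 1 : ℝ) ^ N := by
        rw [← Real.rpow_natCast]
        gcongr
        simp
    _ = Real.exp c * (((k + 1 : ℕ) : ℝ) ^ N * Real.exp (-c * (k + 1 : ℕ))) := by
        rw [mul_left_comm, ← Real.exp_add, mul_comm]
        push_cast
        ring_nf

section NormedSpace

variable {F : Type*} [NormedAddCommGroup F] [NormedSpace ℝ F] [MeasurableSpace F] [BorelSpace F]
  {a : ℝ} {μ : Measure F}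

theorem IsHomogeneousMeasure.lintegral_exp_neg_mul_norm_lt_top (h : IsHomogeneousMeasure a μ)
    (hfin : μ (Metric.closedBall 0 1) < ⊤) {c : ℝ} (hc : 0 < c) :
    ∫⁻ x, ENNReal.ofReal (Real.exp (-(c * ‖x‖))) ∂μ < ⊤ := by
  have hball (k : ℕ) : MeasurableSet (Metric.closedBall (0 : F) (k + 1 : ℝ)) :=
    Metric.isClosed_closedBall.measurableSet
  calc ∫⁻ x, ENNReal.ofReal (Real.exp (-(c * ‖x‖))) ∂μ
      ≤ ∫⁻ x, ∑' k : ℕ, (Metric.closedBall (0 : F) (k + 1 : ℝ)).indicator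
          (fun _ => ENNReal.ofReal (Real.exp (-(c * k)))) x ∂μ :=
        lintegral_mono (ofReal_exp_neg_mul_norm_le_tsum hc.le)
    _ = ∑' k : ℕ, ENNReal.ofReal (Real.exp (-(c * k)) * (k + 1 : ℝ) ^ a) *
          μ (Metric.closedBall 0 1) := by
        rw [lintegral_tsum fun k => (measurable_const.indicator (hball k)).aemeasurable]
        congr 1 with k
        rw [lintegral_indicator_const (hball k), h.closedBall_eq (by positivity), ← mul_assoc,
          ← ENNReal.ofReal_mul (Real.exp_nonneg _)]
    _ < ⊤ := by
        rw [ENNReal.tsum_mul_right]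
        exact ENNReal.mul_lt_top (summable_exp_neg_mul_rpow hc a).tsum_ofReal_lt_top hfin

theorem IsHomogeneousMeasure.lintegral_expNeg_lt_top (h : IsHomogeneousMeasure a μ)
    (hfin : μ (Metric.closedBall 0 1) < ⊤) {α c d : ℝ} (hα : 0 < α) (hc : 0 < c) {f : F → EReal}
    (hf : ∀ x, ((c * ‖x‖ - d : ℝ) : EReal) ≤ f x) : ∫⁻ x, expNeg α (f x) ∂μ < ⊤ := by
  refine (lintegral_mono fun x => expNeg_antitone hα.le (hf x)).trans_lt ?_
  have hfactor (x : F) : expNeg α ((c * ‖x‖ - d : ℝ) : EReal) =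
      ENNReal.ofReal (Real.exp (α * d)) * ENNReal.ofReal (Real.exp (-((α * c) * ‖x‖))) := by
    rw [expNeg_coe, ← ENNReal.ofReal_mul (Real.exp_nonneg _), ← Real.exp_add]
    ring_nf
  simp_rw [hfactor]
  rw [lintegral_const_mul' _ _ ENNReal.ofReal_ne_top]
  exact ENNReal.mul_lt_top ENNReal.ofReal_lt_top
    (h.lintegral_exp_neg_mul_norm_lt_top hfin (mul_pos hα hc))

theorem isHomogeneousMeasure_addHaar [FiniteDimensional ℝ F] (μ : Measure F)
    [μ.IsAddHaarMeasure] : IsHomogeneousMeasure (Module.finrank ℝ F) μ := by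
  intro r hr
  rw [Measure.map_addHaar_smul _ hr.ne', abs_of_pos (by positivity), Real.rpow_neg hr.le,
    Real.rpow_natCast]

end NormedSpace

theorem isHomogeneousMeasure_volume : IsHomogeneousMeasure (n : ℝ) (volume : Measure (E n)) := by
  simpa only [finrank_euclideanSpace_fin] using
    isHomogeneousMeasure_addHaar (volume : Measure (E n))

section Integrals

variable {X : Type*} [MeasurableSpace X] {μ : Measure X}

theorem expNeg_mul_measure_le_lintegral {a : ℝ} (ha : 0 ≤ a) {A : Set X} (hA : MeasurableSet A)
    {f : X → EReal} {m : EReal} (hf : ∀ x ∈ A, f x ≤ m) :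
    expNeg a m * μ A ≤ ∫⁻ x, expNeg a (f x) ∂μ := by
  rw [← setLIntegral_const]
  exact (setLIntegral_mono' hA fun x hx => expNeg_antitone ha (hf x hx)).trans
    (setLIntegral_le_lintegral A _)

theorem limsup_lintegral_le_of_aemeasurable {f : ℕ → X → ENNReal} (g : X → ENNReal)
    (hf : ∀ k, AEMeasurable (f k) μ) (hbound : ∀ k, f k ≤ᵐ[μ] g) (hg : ∫⁻ x, g x ∂μ ≠ ⊤) :
    limsup (fun k => ∫⁻ x, f k x ∂μ) atTop ≤ ∫⁻ x, limsup (fun k => f k x) atTop ∂μ := by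
  have hmk : ∀ᵐ x ∂μ, ∀ k, f k x = (hf k).mk (f k) x := ae_all_iff.2 fun k => (hf k).ae_eq_mk
  calc limsup (fun k => ∫⁻ x, f k x ∂μ) atTop
      = limsup (fun k => ∫⁻ x, (hf k).mk (f k) x ∂μ) atTop := by
        simp_rw [fun k => lintegral_congr_ae (hf k).ae_eq_mk]
    _ ≤ ∫⁻ x, limsup (fun k => (hf k).mk (f k) x) atTop ∂μ :=
        limsup_lintegral_le g (fun k => (hf k).measurable_mk)
          (fun k => (hf k).ae_eq_mk.symm.le.trans (hbound k)) hg
    _ = ∫⁻ x, limsup (fun k => f k x) atTop ∂μ :=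
        lintegral_congr_ae (by filter_upwards [hmk] with x hx using by simp_rw [hx])

end Integrals

/-! ### Gradients of homogeneous functions -/

theorem measurable_gradient {F : Type*} [NormedAddCommGroup F] [InnerProductSpace ℝ F]
    [CompleteSpace F] [MeasurableSpace F] [BorelSpace F] (V : F → ℝ) :
    Measurable (gradient V) :=
  (InnerProductSpace.toDual ℝ F).symm.continuous.measurable.comp (measurable_fderiv ℝ V)

theorem ae_differentiableAt_of_locallyLipschitz {F G : Type*} [NormedAddCommGroup F]
    [NormedSpace ℝ F] [FiniteDimensional ℝ F] [MeasurableSpace F] [BorelSpace F]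
    [NormedAddCommGroup G] [NormedSpace ℝ G] [FiniteDimensional ℝ G] {μ : Measure F}
    [μ.IsAddHaarMeasure] {f : F → G} (hf : LocallyLipschitz f) :
    ∀ᵐ x ∂μ, DifferentiableAt ℝ f x := by
  have : ProperSpace F := FiniteDimensional.proper_real F
  have hball (k : ℕ) : ∀ᵐ x ∂μ, x ∈ Metric.closedBall (0 : F) k →
      DifferentiableWithinAt ℝ f (Metric.closedBall 0 k) x := by
    obtain ⟨K, hK⟩ := (hf.locallyLipschitzOn (s := Metric.closedBall (0 : F) k))
      |>.exists_lipschitzOnWith_of_compact (isCompact_closedBall _ _)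
    exact hK.ae_differentiableWithinAt_of_mem
  filter_upwards [ae_all_iff.2 hball] with x hx
  obtain ⟨k, hk⟩ := exists_nat_gt ‖x‖
  exact (hx k (mem_closedBall_zero_iff.2 hk.le)).differentiableAt
    (Metric.closedBall_mem_nhds_of_mem (mem_ball_zero_iff.2 hk))

section Gradient

variable {p : ℝ} {V : E n → ℝ}

theorem IsHomogeneousOfDegree.gradient_smul (h : IsHomogeneousOfDegree p V) {r : ℝ} (hr : 0 < r)
    {x : E n} (hx : x ≠ 0) : gradient V (r • x) = r ^ (p - 1) • gradient V x := by
  have hV : (fun y => V (r • y)) =ᶠ[𝓝 x] r ^ p • V := by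
    filter_upwards [eventually_ne_nhds hx] with y hy using h r y hr hy
  have hfderiv : r • fderiv ℝ V (r • x) = r ^ p • fderiv ℝ V x := by
    rw [← fderiv_comp_smul, hV.fderiv_eq, fderiv_const_smul_field]
    rfl
  have hdual : fderiv ℝ V (r • x) = r ^ (p - 1) • fderiv ℝ V x := by
    rw [Real.rpow_sub_one hr.ne', div_eq_inv_mul, mul_smul, ← hfderiv, inv_smul_smul₀ hr.ne']
  rw [gradient, gradient, hdual, map_smulₛₗ]
  rfl

theorem IsHomogeneousOfDegree.inner_gradient (h : IsHomogeneousOfDegree p V) {x : E n}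
    (hx : x ≠ 0) (hd : DifferentiableAt ℝ V x) : inner ℝ (gradient V x) x = p * V x := by
  have hray : HasDerivAt (fun r : ℝ => V (r • x)) (inner ℝ (gradient V x) x) 1 := by
    have hgrad : HasFDerivAt V (fderiv ℝ V x) ((1 : ℝ) • x) := by simpa using hd.hasFDerivAt
    have hline : HasDerivAt (fun r : ℝ => r • x) x 1 := by
      simpa using (hasDerivAt_id (1 : ℝ)).smul_const x
    rw [gradient, InnerProductSpace.toDual_symm_apply]
    exact hgrad.comp_hasDerivAt (1 : ℝ) hline
  have hpow : HasDerivAt (fun r : ℝ => r ^ p * V x) (p * V x) 1 := by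
    simpa using (Real.hasDerivAt_rpow_const (x := 1) (p := p) (.inl one_ne_zero)).mul_const (V x)
  refine hray.unique (hpow.congr_of_eventuallyEq ?_)
  filter_upwards [lt_mem_nhds (zero_lt_one (α := ℝ))] with r hr using h r x hr hx

theorem IsHomogeneousOfDegree.exists_mul_norm_rpow_le (h : IsHomogeneousOfDegree p V)
    (hV : Continuous V) (hpos : ∀ x, x ≠ 0 → 0 < V x) :
    ∃ c : ℝ, 0 < c ∧ ∀ x, x ≠ 0 → c * ‖x‖ ^ p ≤ V x := by
  obtain ⟨c, hc, hmin⟩ := (isCompact_sphere (0 : E n) 1).exists_forall_le' hV.continuousOn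
    (a := 0) fun z hz => hpos z (ne_zero_of_mem_unit_sphere ⟨z, hz⟩)
  refine ⟨c, hc, fun x hx => ?_⟩
  have hx' : 0 < ‖x‖ := norm_pos_iff.2 hx
  have hhom := h ‖x‖ (‖x‖⁻¹ • x) hx' (smul_ne_zero (inv_ne_zero hx'.ne') hx)
  rw [smul_inv_smul₀ hx'.ne'] at hhom
  rw [hhom, mul_comm]
  gcongr
  exact hmin _ (by simp [norm_smul, hx'.ne'])

theorem IsHomogeneousOfDegree.mul_norm_rpow_sub_one_le_norm_gradient
    (h : IsHomogeneousOfDegree p V) (hp : 0 ≤ p) {c : ℝ} {x : E n} (hc : c * ‖x‖ ^ p ≤ V x)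
    (hx : x ≠ 0) (hd : DifferentiableAt ℝ V x) : p * c * ‖x‖ ^ (p - 1) ≤ ‖gradient V x‖ := by
  have hx' : 0 < ‖x‖ := norm_pos_iff.2 hx
  refine le_of_mul_le_mul_right ?_ hx'
  calc p * c * ‖x‖ ^ (p - 1) * ‖x‖ = p * (c * ‖x‖ ^ p) := by
        rw [mul_assoc, ← Real.rpow_add_one hx'.ne', sub_add_cancel, mul_assoc]
    _ ≤ p * V x := by gcongr
    _ = inner ℝ (gradient V x) x := (h.inner_gradient hx hd).symm
    _ ≤ ‖gradient V x‖ * ‖x‖ := real_inner_le_norm _ _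

theorem IsHomogeneousOfDegree.isHomogeneousMeasure_map_gradient [NeZero n]
    (h : IsHomogeneousOfDegree p V) (hp : p ≠ 1) :
    IsHomogeneousMeasure (n / (p - 1)) (volume.map (gradient V)) :=
  isHomogeneousMeasure_volume.map (measurable_gradient V) (sub_ne_zero.2 hp) fun r hr => by
    filter_upwards [Measure.ae_ne volume (0 : E n)] with x hx using h.gradient_smul hr hx

theorem IsHomogeneousOfDegree.map_gradient_closedBall_lt_top (h : IsHomogeneousOfDegree p V)
    (hp : 1 < p) (hV : Continuous V) (hd : ∀ᵐ x, DifferentiableAt ℝ V x)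
    (hpos : ∀ x, x ≠ 0 → 0 < V x) :
    volume.map (gradient V) (Metric.closedBall 0 1) < ⊤ := by
  obtain ⟨c, hc, hVc⟩ := h.exists_mul_norm_rpow_le hV hpos
  rw [Measure.map_apply (measurable_gradient V) Metric.isClosed_closedBall.measurableSet]
  refine (measure_mono_ae (t := Metric.closedBall 0 ((p * c)⁻¹ ^ (p - 1)⁻¹)) ?_).trans_lt
    (isCompact_closedBall _ _).measure_lt_top
  filter_upwards [hd] with x hx hgrad
  refine mem_closedBall_zero_iff.2 ?_
  rcases eq_or_ne x 0 with rfl | hx0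
  · rw [norm_zero]
    positivity
  rw [Real.le_rpow_inv_iff_of_pos (norm_nonneg x) (by positivity) (sub_pos.2 hp),
    ← one_div, le_div_iff₀' (by positivity)]
  exact (h.mul_norm_rpow_sub_one_le_norm_gradient (by positivity) (hVc x hx0) hx0 hx).trans
    (mem_closedBall_zero_iff.1 hgrad)

end Gradient

/-! ### Normalized functions -/

theorem exists_norm_le_card_mul_abs {ι : Type*} [Fintype ι] [Nonempty ι]
    (x : EuclideanSpace ℝ ι) : ∃ i, ‖x‖ ≤ Fintype.card ι * |x i| := by
  classical
  obtain ⟨i, hi⟩ := Finite.exists_max fun i => |x i|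
  refine ⟨i, ?_⟩
  calc ‖x‖ = ‖∑ j, x j • EuclideanSpace.basisFun ι ℝ j‖ := by
        simpa using congrArg norm ((EuclideanSpace.basisFun ι ℝ).sum_repr x).symm
    _ ≤ ∑ j, |x j| := norm_sum_le_of_le _ fun j _ => by simp [norm_smul]
    _ ≤ Fintype.card ι * |x i| := by
        simpa using Finset.sum_le_card_nsmul Finset.univ _ _ fun j _ => hi j

section Axis

variable {Φ : E n → EReal}

theorem IsConvexFun.norm_sub_one_le_of_axis (h : IsConvexFun Φ) (hs : IsOneSymmetric Φ)
    (h0 : Φ 0 ≤ 0) (hnonneg : ∀ x, 0 ≤ Φ x) {i : Fin n} {t : ℝ} (ht : 0 < t)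
    (hge : (1 : ℝ) ≤ Φ (EuclideanSpace.single i t)) (x : E n) :
    ((1 / (n * t) * ‖x‖ - 1 : ℝ) : EReal) ≤ Φ x := by
  have : Nonempty (Fin n) := ⟨i⟩
  have hn : (0 : ℝ) < n := Nat.cast_pos.2 i.pos
  obtain ⟨j, hj⟩ := exists_norm_le_card_mul_abs x
  have hnorm : 1 / (n * t) * ‖x‖ ≤ |x j| / t := by
    rw [Fintype.card_fin] at hj
    rw [one_div_mul_eq_div, div_le_div_iff₀ (by positivity) ht]
    nlinarith
  rcases le_or_gt (|x j| / t) 1 with hle | hlt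
  · exact (EReal.coe_le_coe_iff.2 (by linarith)).trans (hnonneg x)
  · have hray := h.mul_le_apply_smul h0 (hge.trans_eq (hs.apply_single_eq i j t)) hlt.le
    have haxis : Φ ((|x j| / t) • EuclideanSpace.single j t) ≤ Φ x := by
      refine h.le_of_abs_le hs.isUnconditional fun k => ?_
      rcases eq_or_ne k j with rfl | hk
      · simp [ht.ne']
      · simp [hk]
    exact (EReal.coe_le_coe_iff.2 (by linarith)).trans (hray.trans haxis)

theorem IsConvexFun.le_of_axis (h : IsConvexFun Φ) (hs : IsOneSymmetric Φ) {i : Fin n} {t : ℝ}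
    {m : EReal} (hle : Φ (EuclideanSpace.single i t) ≤ m) {x : E n}
    (hx : ∀ k, |x k| ≤ t / n) : Φ x ≤ m := by
  have hn : (n : ℝ) ≠ 0 := Nat.cast_ne_zero.2 i.pos.ne'
  have hbarycenter : Φ (∑ j : Fin n, (1 / n : ℝ) • EuclideanSpace.single j t) ≤ m :=
    (h.convex_le m).sum_mem (fun _ _ => by positivity) (by simp [hn])
      fun j _ => (hs.apply_single_eq j i t).trans_le hle
  refine (h.le_of_abs_le hs.isUnconditional fun k => ?_).trans hbarycenter
  have hcoord : (∑ j : Fin n, (1 / n : ℝ) • EuclideanSpace.single j t) k = t / n := by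
    simp [Pi.single_apply, div_eq_inv_mul]
  rw [hcoord]
  exact (hx k).trans (le_abs_self _)

end Axis

theorem tendsto_top_of_le_norm {F : Type*} [SeminormedAddCommGroup F] [ProperSpace F]
    {f : F → EReal} {c d : ℝ} (hc : 0 < c) (h : ∀ x, ((c * ‖x‖ - d : ℝ) : EReal) ≤ f x) :
    Tendsto f (cocompact F) (𝓝 ⊤) := by
  refine tendsto_nhds_top_mono (EReal.tendsto_coe_nhds_top_iff.2 ?_) (Eventually.of_forall h)
  exact tendsto_atTop_add_const_right _ _ ((tendsto_norm_cocompact_atTop).const_mul_atTop hc)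

/-- Convex `1`-symmetric functions bounded below by the cone `c‖x‖ - 1` and bounded above by `1`
on the ball of radius `c`. For `c = 1 / (2n)` every function in the class has a rescaling of this
kind, and the bounds are uniform enough to extract limits of maximizing sequences. -/
structure IsNormalized (c : ℝ) (Φ : E n → EReal) : Prop where
  convex : IsConvexFun Φ
  symm : IsOneSymmetric Φ
  lower : ∀ x, ((c * ‖x‖ - 1 : ℝ) : EReal) ≤ Φ x
  upper : ∀ x, ‖x‖ ≤ c → Φ x ≤ ((1 : ℝ) : EReal)

namespace IsNormalized

variable {c : ℝ}

theorem mem_classOneSymmetric {Φ : E n → EReal} (h : IsNormalized c Φ) (hc : 0 < c) :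
    Φ ∈ classOneSymmetric n where
  left :=
    { ne_bot := fun x => ((EReal.bot_lt_coe _).trans_le (h.lower x)).ne'
      convex := h.convex
      even := h.symm.isUnconditional.even
      interior_dom := ⟨0, mem_interior_iff_mem_nhds.2 <| by
        filter_upwards [Metric.closedBall_mem_nhds (0 : E n) hc] with x hx
        exact (h.upper x (mem_closedBall_zero_iff.1 hx)).trans_lt (EReal.coe_lt_top 1)⟩
      coercive := tendsto_top_of_le_norm hc h.lower }
  right := h.symm

theorem le_legendre {Φ : E n → EReal} (h : IsNormalized c Φ) (hc : 0 ≤ c) (y : E n) :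
    ((c * ‖y‖ - 1 : ℝ) : EReal) ≤ legendre Φ y := by
  have hnorm : ‖(c / ‖y‖) • y‖ ≤ c := by
    rw [norm_smul, norm_div, norm_norm, Real.norm_of_nonneg hc, div_mul_eq_mul_div, mul_div_assoc]
    exact mul_le_of_le_one_right hc (div_self_le_one _)
  have hinner : inner ℝ ((c / ‖y‖) • y) y = c * ‖y‖ := by
    rw [real_inner_smul_left, real_inner_self_eq_norm_mul_norm, div_mul_eq_mul_div,
      mul_div_assoc, mul_self_div_self]
  calc ((c * ‖y‖ - 1 : ℝ) : EReal)
      = ((inner ℝ ((c / ‖y‖) • y) y : ℝ) : EReal) - ((1 : ℝ) : EReal) := by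
        rw [hinner, EReal.coe_sub]
    _ ≤ ((inner ℝ ((c / ‖y‖) • y) y : ℝ) : EReal) - Φ ((c / ‖y‖) • y) :=
        EReal.sub_le_sub le_rfl (h.upper _ hnorm)
    _ ≤ legendre Φ y := BlaschkeSantalo.le_legendre Φ _ y

theorem limsup {ι : Type*} {l : Filter ι} [l.NeBot] {Φ : ι → E n → EReal}
    (h : ∀ k, IsNormalized c (Φ k)) : IsNormalized c fun x => limsup (fun k => Φ k x) l where
  convex := IsConvexFun.limsup fun k => (h k).convex
  symm := IsOneSymmetric.limsup fun k => (h k).symm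
  lower x := le_limsup_of_frequently_le (Frequently.of_forall fun k => (h k).lower x)
  upper x hx := limsup_le_of_le (h := Eventually.of_forall fun k => (h k).upper x hx)

end IsNormalized

theorem exists_isNormalized_rescale [NeZero n] {Φ : E n → EReal}
    (h : Φ ∈ classOneSymmetric n) :
    ∃ r : ℝ, 0 < r ∧ ∃ c : ℝ, IsNormalized (1 / (n * 2)) (rescale r c Φ) := by
  obtain ⟨c₀, hc₀⟩ := h.1.exists_apply_zero
  have hc₀_lt : Φ 0 < ((c₀ + 1 : ℝ) : EReal) :=
    hc₀.trans_lt (EReal.coe_lt_coe_iff.2 (lt_add_one c₀))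
  have hsub : ((c₀ + 1 : ℝ) : EReal) + ((-c₀ : ℝ) : EReal) = (1 : ℝ) := by
    norm_cast
    ring
  obtain ⟨r, hr, hle, hge⟩ := h.1.exists_dilation hc₀_lt
    (x := EuclideanSpace.single (0 : Fin n) 1) (by simp)
  have smul_axis (t : ℝ) : t • EuclideanSpace.single (0 : Fin n) (1 : ℝ) =
      EuclideanSpace.single 0 t := by
    ext k
    simp
  rw [smul_axis] at hle hge
  have hzero : rescale r (-c₀) Φ 0 = 0 := by
    rw [rescale, smul_zero, hc₀, ← EReal.coe_add, add_neg_cancel, EReal.coe_zero]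
  have hnonneg (x : E n) : 0 ≤ rescale r (-c₀) Φ x := by
    rw [← hzero, rescale, smul_zero]
    exact add_le_add_left (h.1.apply_zero_le _) _
  have haxis_le : rescale r (-c₀) Φ (EuclideanSpace.single 0 (1 / 2)) ≤ (1 : ℝ) :=
    (add_le_add_left hle _).trans_eq hsub
  have haxis_ge : (1 : ℝ) ≤ rescale r (-c₀) Φ (EuclideanSpace.single 0 2) :=
    hsub.symm.trans_le (add_le_add_left hge _)
  refine ⟨r, hr, -c₀, h.1.convex.rescale r (-c₀), h.2.rescale r (-c₀), ?_, fun x hx => ?_⟩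
  · exact (h.1.convex.rescale r (-c₀)).norm_sub_one_le_of_axis (h.2.rescale r (-c₀)) hzero.le
      hnonneg two_pos haxis_ge
  · refine (h.1.convex.rescale r (-c₀)).le_of_axis (h.2.rescale r (-c₀)) haxis_le fun k => ?_
    refine (PiLp.norm_apply_le x k).trans (hx.trans_eq ?_)
    rw [div_div, mul_comm]

/-! ### The functional attached to a pair of measures -/

/-- The functional `(∫ e^{-αΦ} dμ)^{1/α} (∫ e^{-βΦ*} dν)^{1/β}`, of which both `BS` (with
`μ = ρ₁ dx`, `ν = ρ₂ dx`) and `BSV` (with `ν` the push-forward of `dx` by `∇V`) are instances. -/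
noncomputable def BSMeasure (α β : ℝ) (μ ν : Measure (E n)) (Φ : E n → EReal) : ENNReal :=
  (∫⁻ x, expNeg α (Φ x) ∂μ) ^ (1 / α) * (∫⁻ y, expNeg β (legendre Φ y) ∂ν) ^ (1 / β)

section Functional

variable {α β a b c d : ℝ} {μ ν : Measure (E n)}

theorem lintegral_expNeg_rescale (hα : 0 < α) (hμ : IsHomogeneousMeasure a μ) {r : ℝ}
    (hr : 0 < r) (c : ℝ) (Φ : E n → EReal) :
    ∫⁻ x, expNeg α (rescale r c Φ x) ∂μ =
      ENNReal.ofReal (Real.exp (α * -c) * r ^ (-a)) * ∫⁻ x, expNeg α (Φ x) ∂μ := by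
  simp_rw [rescale, expNeg_add_coe hα]
  rw [lintegral_mul_const' _ _ ENNReal.ofReal_ne_top,
    hμ.lintegral_comp_smul hr fun x => expNeg α (Φ x), ENNReal.ofReal_mul (Real.exp_nonneg _),
    mul_neg, mul_comm, mul_assoc]

theorem lintegral_expNeg_legendre_rescale (hβ : 0 < β) (hν : IsHomogeneousMeasure b ν) {r : ℝ}
    (hr : 0 < r) (c : ℝ) (Φ : E n → EReal) :
    ∫⁻ y, expNeg β (legendre (rescale r c Φ) y) ∂ν =
      ENNReal.ofReal (Real.exp (β * c) * r ^ b) * ∫⁻ y, expNeg β (legendre Φ y) ∂ν := by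
  simp_rw [legendre_rescale hr.ne']
  have hrescale := lintegral_expNeg_rescale hβ hν (inv_pos.2 hr) (-c) (legendre Φ)
  rwa [neg_neg, Real.inv_rpow hr.le, Real.rpow_neg hr.le, inv_inv] at hrescale

theorem exp_mul_rpow_rpow_one_div (hα : α ≠ 0) {r : ℝ} (hr : 0 < r) (c a : ℝ) :
    (Real.exp (α * c) * r ^ a) ^ (1 / α) = Real.exp c * r ^ (a / α) := by
  rw [Real.mul_rpow (Real.exp_nonneg _) (by positivity), ← Real.exp_mul, ← Real.rpow_mul hr.le,
    mul_one_div, mul_one_div, mul_div_cancel_left₀ c hα]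

theorem BSMeasure_rescale (hα : 0 < α) (hβ : 0 < β) (hab : a / α = b / β)
    (hμ : IsHomogeneousMeasure a μ) (hν : IsHomogeneousMeasure b ν) {r : ℝ} (hr : 0 < r) (c : ℝ)
    (Φ : E n → EReal) : BSMeasure α β μ ν (rescale r c Φ) = BSMeasure α β μ ν Φ := by
  have hfactor : Real.exp (-c) * r ^ (-a / α) * (Real.exp c * r ^ (b / β)) = 1 := by
    rw [mul_mul_mul_comm, ← Real.exp_add, ← Real.rpow_add hr, neg_add_cancel, neg_div, hab,
      neg_add_cancel, Real.exp_zero, Real.rpow_zero, one_mul]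
  rw [BSMeasure, lintegral_expNeg_rescale hα hμ hr, lintegral_expNeg_legendre_rescale hβ hν hr,
    ENNReal.mul_rpow_of_nonneg _ _ (by positivity), ENNReal.mul_rpow_of_nonneg _ _ (by positivity),
    mul_mul_mul_comm, ENNReal.ofReal_rpow_of_pos (by positivity),
    ENNReal.ofReal_rpow_of_pos (by positivity), exp_mul_rpow_rpow_one_div hα.ne' hr,
    exp_mul_rpow_rpow_one_div hβ.ne' hr, ← ENNReal.ofReal_mul (by positivity), hfactor,
    ENNReal.ofReal_one, one_mul, BSMeasure]

theorem BSMeasure_lt_top (hα : 0 < α) (hβ : 0 < β) (hμ : IsHomogeneousMeasure a μ)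
    (hν : IsHomogeneousMeasure b ν) (hμfin : μ (Metric.closedBall 0 1) < ⊤)
    (hνfin : ν (Metric.closedBall 0 1) < ⊤) (hc : 0 < c) {Φ : E n → EReal}
    (hΦ : IsNormalized c Φ) : BSMeasure α β μ ν Φ < ⊤ :=
  ENNReal.mul_lt_top
    (ENNReal.rpow_lt_top_of_nonneg (by positivity)
      (hμ.lintegral_expNeg_lt_top hμfin hα hc hΦ.lower).ne)
    (ENNReal.rpow_lt_top_of_nonneg (by positivity)
      (hν.lintegral_expNeg_lt_top hνfin hβ hc (hΦ.le_legendre hc.le)).ne)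

/-! ### Upper semicontinuity -/

theorem limsup_le_liminf_smul {ι : Type*} {l : Filter ι} [l.NeBot] {Φ : ι → E n → EReal}
    (hconv : ∀ k, IsConvexFun (Φ k)) (hsymm : ∀ k, IsUnconditional (Φ k))
    (hlim : ∀ q : Fin n → ℚ, ∃ v, Tendsto (fun k => Φ k (WithLp.toLp 2 fun i => (q i : ℝ))) l (𝓝 v))
    {r : ℝ} (hr : 1 < r) (x : E n) :
    limsup (fun k => Φ k x) l ≤ liminf (fun k => Φ k (r • x)) l := by
  have exists_rat (i : Fin n) : ∃ q : ℚ, |x i| ≤ |(q : ℝ)| ∧ |(q : ℝ)| ≤ |r * x i| := by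
    rcases eq_or_ne (x i) 0 with hx | hx
    · exact ⟨0, by simp [hx]⟩
    obtain ⟨q, hxq, hqr⟩ := exists_rat_btwn (lt_mul_of_one_lt_left (abs_pos.2 hx) hr)
    have hq : (0 : ℝ) ≤ q := (abs_nonneg _).trans hxq.le
    refine ⟨q, ?_⟩
    rw [abs_of_nonneg hq, abs_mul, abs_of_pos (one_pos.trans hr)]
    exact ⟨hxq.le, hqr.le⟩
  choose q hxq hqr using exists_rat
  obtain ⟨v, hv⟩ := hlim q
  calc limsup (fun k => Φ k x) l
      ≤ limsup (fun k => Φ k (WithLp.toLp 2 fun i => (q i : ℝ))) l :=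
        limsup_le_limsup (Eventually.of_forall fun k => (hconv k).le_of_abs_le (hsymm k) hxq)
    _ = liminf (fun k => Φ k (WithLp.toLp 2 fun i => (q i : ℝ))) l :=
        hv.limsup_eq.trans hv.liminf_eq.symm
    _ ≤ liminf (fun k => Φ k (r • x)) l :=
        liminf_le_liminf (Eventually.of_forall fun k => (hconv k).le_of_abs_le (hsymm k) hqr)

section Sequence

variable {Φ : ℕ → E n → EReal}

theorem limsup_lintegral_expNeg_smul_le (hα : 0 < α) (hμac : μ ≪ volume)
    (hμ : IsHomogeneousMeasure a μ) (hμfin : μ (Metric.closedBall 0 1) < ⊤) (hc : 0 < c)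
    (hlower : ∀ k x, ((c * ‖x‖ - d : ℝ) : EReal) ≤ Φ k x)
    (hconv : ∀ k, IsConvexFun (Φ k)) (hsymm : ∀ k, IsUnconditional (Φ k))
    (hlim : ∀ q : Fin n → ℚ,
      ∃ v, Tendsto (fun k => Φ k (WithLp.toLp 2 fun i => (q i : ℝ))) atTop (𝓝 v))
    {r : ℝ} (hr : 1 < r) :
    limsup (fun k => ∫⁻ x, expNeg α (Φ k (r • x)) ∂μ) atTop ≤
      ∫⁻ x, expNeg α (limsup (fun k => Φ k x) atTop) ∂μ := by
  have hlower_smul (k : ℕ) (x : E n) : ((c * ‖x‖ - d : ℝ) : EReal) ≤ Φ k (r • x) := by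
    refine (EReal.coe_le_coe_iff.2 ?_).trans (hlower k (r • x))
    rw [norm_smul, Real.norm_of_nonneg (one_pos.trans hr).le]
    gcongr
    exact le_mul_of_one_le_left (norm_nonneg x) hr.le
  calc limsup (fun k => ∫⁻ x, expNeg α (Φ k (r • x)) ∂μ) atTop
      ≤ ∫⁻ x, limsup (fun k => expNeg α (Φ k (r • x))) atTop ∂μ :=
        limsup_lintegral_le_of_aemeasurable (fun x => expNeg α ((c * ‖x‖ - d : ℝ) : EReal))
          (fun k => (measurable_expNeg hα).comp_aemeasurable
            (((hconv k).comp_smul r).aemeasurable.mono_ac hμac))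
          (fun k => ae_of_all _ fun x => expNeg_antitone hα.le (hlower_smul k x))
          (hμ.lintegral_expNeg_lt_top hμfin hα hc fun _ => le_rfl).ne
    _ ≤ ∫⁻ x, expNeg α (limsup (fun k => Φ k x) atTop) ∂μ :=
        lintegral_mono fun x => (limsup_expNeg hα _).trans_le
          (expNeg_antitone hα.le (limsup_le_liminf_smul hconv hsymm hlim hr x))

theorem limsup_lintegral_expNeg_le (hα : 0 < α) (hμac : μ ≪ volume)
    (hμ : IsHomogeneousMeasure a μ) (hμfin : μ (Metric.closedBall 0 1) < ⊤) (hc : 0 < c)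
    (hlower : ∀ k x, ((c * ‖x‖ - d : ℝ) : EReal) ≤ Φ k x)
    (hconv : ∀ k, IsConvexFun (Φ k)) (hsymm : ∀ k, IsUnconditional (Φ k))
    (hlim : ∀ q : Fin n → ℚ,
      ∃ v, Tendsto (fun k => Φ k (WithLp.toLp 2 fun i => (q i : ℝ))) atTop (𝓝 v)) :
    limsup (fun k => ∫⁻ x, expNeg α (Φ k x) ∂μ) atTop ≤
      ∫⁻ x, expNeg α (limsup (fun k => Φ k x) atTop) ∂μ := by
  set A := limsup (fun k => ∫⁻ x, expNeg α (Φ k x) ∂μ) atTop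
  have hdilate (r : ℝ) (hr : 1 < r) : ENNReal.ofReal (r ^ (-a)) * A ≤
      ∫⁻ x, expNeg α (limsup (fun k => Φ k x) atTop) ∂μ := by
    rw [← ENNReal.limsup_const_mul_of_ne_top ENNReal.ofReal_ne_top]
    simp_rw [← fun k => hμ.lintegral_comp_smul (one_pos.trans hr) fun x => expNeg α (Φ k x)]
    exact limsup_lintegral_expNeg_smul_le hα hμac hμ hμfin hc hlower hconv hsymm hlim hr
  have hlim_dilate : Tendsto (fun r : ℝ => ENNReal.ofReal (r ^ (-a)) * A) (𝓝[>] 1) (𝓝 A) := by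
    have hrpow : Tendsto (fun r : ℝ => r ^ (-a)) (𝓝[>] 1) (𝓝 1) := by
      simpa using (Real.continuousAt_rpow_const 1 (-a) (.inl one_ne_zero)).tendsto.mono_left
        nhdsWithin_le_nhds
    simpa using ENNReal.Tendsto.mul_const (b := A) (ENNReal.tendsto_ofReal hrpow) (by simp)
  refine le_of_tendsto hlim_dilate ?_
  filter_upwards [self_mem_nhdsWithin] with r hr using hdilate r hr

theorem limsup_lintegral_expNeg_legendre_le (hβ : 0 < β) (hν : IsHomogeneousMeasure b ν)
    (hνfin : ν (Metric.closedBall 0 1) < ⊤) (hc : 0 < c)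
    (hlower : ∀ k y, ((c * ‖y‖ - d : ℝ) : EReal) ≤ legendre (Φ k) y) :
    limsup (fun k => ∫⁻ y, expNeg β (legendre (Φ k) y) ∂ν) atTop ≤
      ∫⁻ y, expNeg β (legendre (fun x => limsup (fun k => Φ k x) atTop) y) ∂ν :=
  (limsup_lintegral_le_of_aemeasurable (fun y => expNeg β ((c * ‖y‖ - d : ℝ) : EReal))
    (fun k => ((measurable_expNeg hβ).comp (measurable_legendre (Φ k))).aemeasurable)
    (fun k => ae_of_all _ fun y => expNeg_antitone hβ.le (hlower k y))
    (hν.lintegral_expNeg_lt_top hνfin hβ hc fun _ => le_rfl).ne).trans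
      (lintegral_mono (limsup_expNeg_legendre_le hβ Φ))

theorem limsup_BSMeasure_le (hα : 0 < α) (hβ : 0 < β) (hμac : μ ≪ volume)
    (hμ : IsHomogeneousMeasure a μ) (hν : IsHomogeneousMeasure b ν)
    (hμfin : μ (Metric.closedBall 0 1) < ⊤) (hνfin : ν (Metric.closedBall 0 1) < ⊤) (hc : 0 < c)
    (hΦ : ∀ k, IsNormalized c (Φ k))
    (hlim : ∀ q : Fin n → ℚ,
      ∃ v, Tendsto (fun k => Φ k (WithLp.toLp 2 fun i => (q i : ℝ))) atTop (𝓝 v)) :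
    limsup (fun k => BSMeasure α β μ ν (Φ k)) atTop ≤
      BSMeasure α β μ ν fun x => limsup (fun k => Φ k x) atTop := by
  have limsup_rpow {γ : ℝ} (hγ : 0 < γ) (u : ℕ → ENNReal) :
      limsup (fun k => u k ^ (1 / γ)) atTop = limsup u atTop ^ (1 / γ) :=
    ((ENNReal.monotone_rpow_of_nonneg (one_div_pos.2 hγ).le).map_limsup_of_continuousAt u
      ENNReal.continuous_rpow_const.continuousAt).symm
  have hΦ₀ := IsNormalized.limsup (l := atTop) hΦ
  have hμle := limsup_lintegral_expNeg_le hα hμac hμ hμfin hc (fun k => (hΦ k).lower)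
    (fun k => (hΦ k).convex) (fun k => (hΦ k).symm.isUnconditional) hlim
  have hνle := limsup_lintegral_expNeg_legendre_le hβ hν hνfin hc
    fun k => (hΦ k).le_legendre hc.le
  have hμlt := hμle.trans_lt (hμ.lintegral_expNeg_lt_top hμfin hα hc hΦ₀.lower)
  have hνlt := hνle.trans_lt (hν.lintegral_expNeg_lt_top hνfin hβ hc (hΦ₀.le_legendre hc.le))
  refine (ENNReal.limsup_mul_le' (.inr ?_) (.inl ?_)).trans ?_
  · rw [limsup_rpow hβ]
    exact ENNReal.rpow_ne_top_of_nonneg (by positivity) hνlt.ne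
  · rw [limsup_rpow hα]
    exact ENNReal.rpow_ne_top_of_nonneg (by positivity) hμlt.ne
  · rw [limsup_rpow hα, limsup_rpow hβ, BSMeasure]
    gcongr

end Sequence

/-! ### Existence of maximizers -/

theorem exists_isMaxOn_isNormalized (hα : 0 < α) (hβ : 0 < β) (hμac : μ ≪ volume)
    (hμ : IsHomogeneousMeasure a μ) (hν : IsHomogeneousMeasure b ν)
    (hμfin : μ (Metric.closedBall 0 1) < ⊤) (hνfin : ν (Metric.closedBall 0 1) < ⊤) (hc : 0 < c)
    (hne : {Φ : E n → EReal | IsNormalized c Φ}.Nonempty) :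
    ∃ Φ, IsNormalized c Φ ∧ IsMaxOn (BSMeasure α β μ ν) {Φ | IsNormalized c Φ} Φ := by
  set K : Set ENNReal := BSMeasure α β μ ν '' {Φ | IsNormalized c Φ}
  obtain ⟨u, -, hu, huK⟩ := exists_seq_tendsto_sSup (hne.image (BSMeasure α β μ ν))
    (OrderTop.bddAbove K)
  choose Φ hΦ hΦu using huK
  obtain ⟨v, φ, hφ, hv⟩ := CompactSpace.tendsto_subseq
    fun k (q : Fin n → ℚ) => Φ k (WithLp.toLp 2 fun i => (q i : ℝ))
  refine ⟨_, IsNormalized.limsup (l := atTop) fun k => hΦ (φ k), fun Ψ hΨ => ?_⟩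
  calc BSMeasure α β μ ν Ψ ≤ sSup K := le_sSup (Set.mem_image_of_mem _ hΨ)
    _ = limsup (fun k => BSMeasure α β μ ν (Φ (φ k))) atTop := by
        simp_rw [hΦu]
        exact (hu.comp hφ.tendsto_atTop).limsup_eq.symm
    _ ≤ _ := limsup_BSMeasure_le hα hβ hμac hμ hν hμfin hνfin hc (fun k => hΦ (φ k))
        fun q => ⟨v q, tendsto_pi_nhds.1 hv q⟩

/-- The Euclidean norm, with extended real values: it maximizes the functional when one of the
two measures vanishes or is infinite near the origin. -/
noncomputable def coeNorm (n : ℕ) : E n → EReal := fun x => ((‖x‖ : ℝ) : EReal)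

theorem coeNorm_mem_classOneSymmetric : coeNorm n ∈ classOneSymmetric n := by
  refine ⟨⟨fun x => EReal.coe_ne_bot _, ?_, fun x => by simp [coeNorm], ?_, ?_⟩, ?_, ?_⟩
  · refine isConvexFun_of_lt fun x y c d a b hx hy ha hb _ => EReal.coe_le_coe_iff.2 ?_
    refine (norm_add_le _ _).trans ?_
    rw [norm_smul, norm_smul, Real.norm_of_nonneg ha, Real.norm_of_nonneg hb]
    gcongr
    exacts [(EReal.coe_lt_coe_iff.1 hx).le, (EReal.coe_lt_coe_iff.1 hy).le]
  · have hdom : effDom (coeNorm n) = Set.univ := Set.eq_univ_of_forall fun x => EReal.coe_lt_top _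
    rw [hdom, interior_univ]
    exact Set.univ_nonempty
  · exact tendsto_top_of_le_norm (c := 1) (d := 0) one_pos fun x => by simp [coeNorm]
  · intro ε hε x
    have habs (i : Fin n) : ‖ε i * x i‖ = ‖x i‖ := by rcases hε i with h | h <;> simp [h]
    simp only [coeNorm, EuclideanSpace.norm_eq, habs]
  · intro σ x
    simp only [coeNorm, EuclideanSpace.norm_eq, Equiv.sum_comp σ fun i => ‖x i‖ ^ 2]

theorem legendre_coeNorm_le_zero {y : E n} (hy : ‖y‖ ≤ 1) : legendre (coeNorm n) y ≤ 0 := by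
  refine iSup_le fun x => ?_
  rw [coeNorm, ← EReal.coe_sub, ← EReal.coe_zero, EReal.coe_le_coe_iff, sub_nonpos]
  exact (real_inner_le_norm x y).trans (mul_le_of_le_one_right (norm_nonneg x) hy)

theorem BSMeasure_coeNorm_eq_top (hα : 0 < α) (hβ : 0 < β) (hμ : IsHomogeneousMeasure a μ)
    (hν : IsHomogeneousMeasure b ν) (hμ0 : μ ≠ 0) (hν0 : ν ≠ 0)
    (h : μ (Metric.closedBall 0 1) = ⊤ ∨ ν (Metric.closedBall 0 1) = ⊤) :
    BSMeasure α β μ ν (coeNorm n) = ⊤ := by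
  have hμle := expNeg_mul_measure_le_lintegral hα.le (μ := μ) (f := coeNorm n) (m := (1 : ℝ))
    Metric.isClosed_closedBall.measurableSet
    fun x hx => EReal.coe_le_coe_iff.2 (mem_closedBall_zero_iff.1 hx)
  have hνle := expNeg_mul_measure_le_lintegral hβ.le (μ := ν) (f := legendre (coeNorm n))
    (m := (0 : ℝ)) Metric.isClosed_closedBall.measurableSet
    fun y hy => legendre_coeNorm_le_zero (mem_closedBall_zero_iff.1 hy)
  have hμpos : ∫⁻ x, expNeg α (coeNorm n x) ∂μ ≠ 0 := fun hzero =>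
    mul_ne_zero (expNeg_coe_ne_zero α 1) (mt hμ.eq_zero hμ0) (le_zero_iff.1 (hμle.trans_eq hzero))
  have hνpos : ∫⁻ y, expNeg β (legendre (coeNorm n) y) ∂ν ≠ 0 := fun hzero =>
    mul_ne_zero (expNeg_coe_ne_zero β 0) (mt hν.eq_zero hν0) (le_zero_iff.1 (hνle.trans_eq hzero))
  rw [BSMeasure, ENNReal.mul_eq_top, ENNReal.rpow_eq_top_iff_of_pos (one_div_pos.2 hα),
    ENNReal.rpow_eq_top_iff_of_pos (one_div_pos.2 hβ), Ne, Ne,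
    ENNReal.rpow_eq_zero_iff_of_pos (one_div_pos.2 hα),
    ENNReal.rpow_eq_zero_iff_of_pos (one_div_pos.2 hβ)]
  rcases h with h | h
  · rw [h, ENNReal.mul_top (expNeg_coe_ne_zero α 1), top_le_iff] at hμle
    exact .inr ⟨hμle, hνpos⟩
  · rw [h, ENNReal.mul_top (expNeg_coe_ne_zero β 0), top_le_iff] at hνle
    exact .inl ⟨hμpos, hνle⟩

theorem BSMeasure_eq_zero (hα : 0 < α) (hβ : 0 < β) (h : μ = 0 ∨ ν = 0) (Φ : E n → EReal) :
    BSMeasure α β μ ν Φ = 0 := by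
  rcases h with rfl | rfl <;> simp [BSMeasure, hα, hβ]

theorem exists_isMaxOn_BSMeasure [NeZero n] (hα : 0 < α) (hβ : 0 < β) (hab : a / α = b / β)
    (hμac : μ ≪ volume) (hμ : IsHomogeneousMeasure a μ) (hν : IsHomogeneousMeasure b ν) :
    ∃ Φ ∈ classOneSymmetric n, IsMaxOn (BSMeasure α β μ ν) (classOneSymmetric n) Φ ∧
      (μ (Metric.closedBall 0 1) < ⊤ → ν (Metric.closedBall 0 1) < ⊤ →
        BSMeasure α β μ ν Φ < ⊤) := by
  by_cases hfin : μ (Metric.closedBall 0 1) < ⊤ ∧ ν (Metric.closedBall 0 1) < ⊤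
  · obtain ⟨hμfin, hνfin⟩ := hfin
    have hc : (0 : ℝ) < 1 / (n * 2) := by
      have := Nat.cast_pos (α := ℝ).2 (NeZero.pos n)
      positivity
    obtain ⟨_, -, _, hnorm⟩ := exists_isNormalized_rescale (coeNorm_mem_classOneSymmetric (n := n))
    obtain ⟨Φ, hΦ, hmax⟩ := exists_isMaxOn_isNormalized hα hβ hμac hμ hν hμfin hνfin hc ⟨_, hnorm⟩
    refine ⟨Φ, hΦ.mem_classOneSymmetric hc, fun Ψ hΨ => ?_,
      fun _ _ => BSMeasure_lt_top hα hβ hμ hν hμfin hνfin hc hΦ⟩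
    obtain ⟨r, hr, e, hΨ'⟩ := exists_isNormalized_rescale hΨ
    exact (BSMeasure_rescale hα hβ hab hμ hν hr e Ψ).symm.trans_le (hmax hΨ')
  · refine ⟨coeNorm n, coeNorm_mem_classOneSymmetric, fun Ψ _ => ?_,
      fun hμfin hνfin => absurd ⟨hμfin, hνfin⟩ hfin⟩
    change BSMeasure α β μ ν Ψ ≤ BSMeasure α β μ ν (coeNorm n)
    by_cases hzero : μ = 0 ∨ ν = 0
    · rw [BSMeasure_eq_zero hα hβ hzero, BSMeasure_eq_zero hα hβ hzero]
    · rw [not_or] at hzero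
      rw [not_and_or, not_lt_top_iff, not_lt_top_iff] at hfin
      rw [BSMeasure_coeNorm_eq_top hα hβ hμ hν hzero.1 hzero.2 hfin]
      exact le_top

end Functional

/-! ### Weights and gradients -/

theorem withDensity_ofReal_closedBall_lt_top {X : Type*} [PseudoMetricSpace X] [ProperSpace X]
    [MeasurableSpace X] [OpensMeasurableSpace X] {μ : Measure X} {ρ : X → ℝ}
    (h : LocallyIntegrable ρ μ) (x : X) (r : ℝ) :
    μ.withDensity (fun x => ENNReal.ofReal (ρ x)) (Metric.closedBall x r) < ⊤ := by
  rw [withDensity_apply _ Metric.isClosed_closedBall.measurableSet]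
  exact (h.integrableOn_isCompact (isCompact_closedBall x r)).lintegral_lt_top

theorem BS_eq_BSMeasure {α β : ℝ} (hα : 0 < α) (hβ : 0 < β) {ρ₁ ρ₂ : E n → ℝ}
    (h₁ : AEMeasurable ρ₁ volume) (h₂ : AEMeasurable ρ₂ volume) {Φ : E n → EReal}
    (hΦ : IsConvexFun Φ) :
    BS α β ρ₁ ρ₂ Φ = BSMeasure α β (volume.withDensity fun x => ENNReal.ofReal (ρ₁ x))
      (volume.withDensity fun x => ENNReal.ofReal (ρ₂ x)) Φ := by
  rw [BS, BSMeasure, lintegral_withDensity_eq_lintegral_mul₀ h₁.ennreal_ofReal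
      (g := fun x => expNeg α (Φ x)) ((measurable_expNeg hα).comp_aemeasurable hΦ.aemeasurable),
    lintegral_withDensity_eq_lintegral_mul₀ h₂.ennreal_ofReal
      (g := fun y => expNeg β (legendre Φ y))
      ((measurable_expNeg hβ).comp (measurable_legendre Φ)).aemeasurable]
  simp only [Pi.mul_apply, expNeg, mul_comm]

theorem BSV_eq_BSMeasure {p : ℝ} (hp : 1 < p) (V : E n → ℝ) (Φ : E n → EReal) :
    BSV p V Φ = BSMeasure 1 (1 / (p - 1)) volume (volume.map (gradient V)) Φ := by
  rw [BSV, BSMeasure, lintegral_map (f := fun y => expNeg (1 / (p - 1)) (legendre Φ y))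
    ((measurable_expNeg (one_div_pos.2 (sub_pos.2 hp))).comp (measurable_legendre Φ))
    (measurable_gradient V)]
  simp [expNeg]

theorem exists_isMaxOn_BS [NeZero n] {α β s t : ℝ} {ρ₁ ρ₂ : E n → ℝ} (hα : 0 < α) (hβ : 0 < β)
    (h₁ : AEMeasurable ρ₁ volume) (h₂ : AEMeasurable ρ₂ volume)
    (hρ₁ : IsHomogeneousOfDegree s ρ₁) (hρ₂ : IsHomogeneousOfDegree t ρ₂)
    (hab : (n + s) / α = (n + t) / β) :
    ∃ Φ ∈ classOneSymmetric n, IsMaxOn (BS α β ρ₁ ρ₂) (classOneSymmetric n) Φ ∧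
      (LocallyIntegrable ρ₁ volume → LocallyIntegrable ρ₂ volume → BS α β ρ₁ ρ₂ Φ < ⊤) := by
  obtain ⟨Φ, hΦ, hmax, hfin⟩ := exists_isMaxOn_BSMeasure hα hβ hab
    (withDensity_absolutelyContinuous _ _) (isHomogeneousMeasure_volume.withDensity hρ₁)
    (isHomogeneousMeasure_volume.withDensity hρ₂)
  have hBS {Ψ : E n → EReal} (hΨ : Ψ ∈ classOneSymmetric n) :=
    BS_eq_BSMeasure hα hβ h₁ h₂ hΨ.1.convex
  refine ⟨Φ, hΦ, fun Ψ hΨ => ?_, fun hl₁ hl₂ => ?_⟩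
  · exact (hBS hΨ).trans_le ((hmax hΨ).trans_eq (hBS hΦ).symm)
  · exact (hBS hΦ).trans_lt (hfin (withDensity_ofReal_closedBall_lt_top hl₁ 0 1)
      (withDensity_ofReal_closedBall_lt_top hl₂ 0 1))

theorem exists_isMaxOn_BSV [NeZero n] {p : ℝ} {V : E n → ℝ} (hp : 1 < p)
    (hd : ∀ᵐ x, DifferentiableAt ℝ V x) (hV : IsHomogeneousOfDegree p V) :
    ∃ Φ ∈ classOneSymmetric n, IsMaxOn (BSV p V) (classOneSymmetric n) Φ ∧
      (Continuous V → (∀ x, x ≠ 0 → 0 < V x) → BSV p V Φ < ⊤) := by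
  have hp1 : 0 < p - 1 := sub_pos.2 hp
  obtain ⟨Φ, hΦ, hmax, hfin⟩ := exists_isMaxOn_BSMeasure one_pos (one_div_pos.2 hp1)
    (a := n) (b := n / (p - 1)) (by field_simp) Measure.AbsolutelyContinuous.rfl
    isHomogeneousMeasure_volume (hV.isHomogeneousMeasure_map_gradient hp.ne')
  rw [← funext (BSV_eq_BSMeasure hp V)] at hmax hfin
  exact ⟨Φ, hΦ, hmax, fun hcont hpos => hfin (isCompact_closedBall _ _).measure_lt_top
    (hV.map_gradient_closedBall_lt_top hp hcont hd hpos)⟩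

end BlaschkeSantalo

theorem mainTheorem12_general (n : ℕ) [NeZero n] :
    (∀ (α β s t : ℝ) (ρ₁ ρ₂ : BlaschkeSantalo.E n → ℝ),
      0 < α → 0 < β → AEMeasurable ρ₁ volume → AEMeasurable ρ₂ volume →
      (∀ x, 0 ≤ ρ₁ x) → (∀ x, 0 ≤ ρ₂ x) →
      BlaschkeSantalo.IsHomogeneousOfDegree s ρ₁ →
      BlaschkeSantalo.IsHomogeneousOfDegree t ρ₂ →
      (n + s) / α = (n + t) / β →
      ∃ Φ ∈ BlaschkeSantalo.classOneSymmetric n,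
        IsMaxOn (BlaschkeSantalo.BS α β ρ₁ ρ₂) (BlaschkeSantalo.classOneSymmetric n) Φ ∧
        (LocallyIntegrable ρ₁ volume → LocallyIntegrable ρ₂ volume →
          BlaschkeSantalo.BS α β ρ₁ ρ₂ Φ < ⊤)) ∧
    (∀ (p : ℝ) (V : BlaschkeSantalo.E n → ℝ),
      1 < p → (∀ᵐ x, DifferentiableAt ℝ V x) → BlaschkeSantalo.IsHomogeneousOfDegree p V →
      ∃ Φ ∈ BlaschkeSantalo.classOneSymmetric n,
        IsMaxOn (BlaschkeSantalo.BSV p V) (BlaschkeSantalo.classOneSymmetric n) Φ ∧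
        (Continuous V → (∀ x, x ≠ 0 → 0 < V x) → BlaschkeSantalo.BSV p V Φ < ⊤)) :=
  ⟨fun _ _ _ _ _ _ hα hβ h₁ h₂ _ _ => BlaschkeSantalo.exists_isMaxOn_BS hα hβ h₁ h₂,
    fun _ _ => BlaschkeSantalo.exists_isMaxOn_BSV⟩

theorem mainTheorem12 (n : ℕ) (hn : 0 < n) :
    (∀ (α β s t : ℝ) (ρ₁ ρ₂ : BlaschkeSantalo.E n → ℝ),
      0 < α → 0 < β → -(n : ℝ) < s → -(n : ℝ) < t →
      AEMeasurable ρ₁ volume → AEMeasurable ρ₂ volume →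
      (∀ x, 0 ≤ ρ₁ x) → (∀ x, 0 ≤ ρ₂ x) →
      BlaschkeSantalo.IsHomogeneousOfDegree s ρ₁ →
      BlaschkeSantalo.IsHomogeneousOfDegree t ρ₂ →
      α / β = ((n : ℝ) + s) / ((n : ℝ) + t) →
      ∃ Φ ∈ BlaschkeSantalo.classOneSymmetric n,
        IsMaxOn (BlaschkeSantalo.BS α β ρ₁ ρ₂) (BlaschkeSantalo.classOneSymmetric n) Φ ∧
        (LocallyIntegrable ρ₁ volume → LocallyIntegrable ρ₂ volume →
          BlaschkeSantalo.BS α β ρ₁ ρ₂ Φ < ⊤)) ∧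
    (∀ (p : ℝ) (V : BlaschkeSantalo.E n → ℝ),
      1 < p → ConvexOn ℝ Set.univ V → BlaschkeSantalo.IsHomogeneousOfDegree p V →
      ∃ Φ ∈ BlaschkeSantalo.classOneSymmetric n,
        IsMaxOn (BlaschkeSantalo.BSV p V) (BlaschkeSantalo.classOneSymmetric n) Φ ∧
        ((∀ x, x ≠ 0 → 0 < V x) → BlaschkeSantalo.BSV p V Φ < ⊤)) := by
  have : NeZero n := ⟨hn.ne'⟩
  obtain ⟨hBS, hBSV⟩ := mainTheorem12_general n
  refine ⟨fun α β s t ρ₁ ρ₂ hα hβ _ ht h₁ h₂ hn₁ hn₂ hρ₁ hρ₂ hαβ => ?_, fun p V hp hV hhom => ?_⟩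
  · refine hBS α β s t ρ₁ ρ₂ hα hβ h₁ h₂ hn₁ hn₂ hρ₁ hρ₂ ?_
    rw [div_eq_div_iff hβ.ne' (by linarith)] at hαβ
    rw [div_eq_div_iff hα.ne' hβ.ne']
    linarith
  · have hlip := hV.locallyLipschitz
    obtain ⟨Φ, hΦ, hmax, hfin⟩ := hBSV p V hp
      (BlaschkeSantalo.ae_differentiableAt_of_locallyLipschitz hlip) hhom
    exact ⟨Φ, hΦ, hmax, hfin hlip.continuous⟩
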